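/- Let $U=U_q^>(L\mathfrak{sl}_2)$ be the associative unital $\mathbb{C}(q)$-algebra generated by $e_r$ ($r\in\mathbb{Z}$) with the defining relation $(z-q^2w)\,e(z)e(w)=(q^2z-w)\,e(w)e(z)$, where $e(z)=\sum_{r\in\mathbb{Z}}e_rz^{-r}$. Put $\mathfrak{q}=q^2$ and $[a,b]_x=ab-x\,ba$. For $n\in\mathbb{Z}$ set $M_{0,n}=1$, $M_{1,n}=e_{-n}$ and, for $k\ge 1$, $$M_{k,n}=\frac{(-1)^{k(k-1)/2}}{(1-\mathfrak{q})^{k-1}}\,\big[\cdots\big[[M_{1,n-k+1},M_{1,n-k+3}]_{\mathfrak{q}^2},M_{1,n-k+5}\big]_{\mathfrak{q}^3},\cdots,M_{1,n+k-1}\big]_{\mathfrak{q}^k}$$ (for $k=1$ there is no bracket, and the formula reads $M_{1,n}=M_{1,n}$). Then for all integers $\alpha,\beta\ge 0$, all $n\in\mathbb{Z}$ and all $\epsilon\in\{0,1\}$, one has in $U$ $$M_{\alpha,n}\,M_{\beta,n+\epsilon}=\mathfrak{q}^{\min(\alpha,\beta)\,\epsilon}\,M_{\beta,n+\epsilon}\,M_{\alpha,n}.$$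 -/

import Mathlib

namespace QLoop

noncomputable section

/-- The ground field `ℂ(q)`. -/
abbrev K : Type := RatFunc ℂ

/-- The formal parameter `q`. -/
def q : K := RatFunc.X

/-- The parameter `𝔮 = q²`. -/
def qq : K := q ^ 2

/-- The quadratic relation `(z - q² w) e(z) e(w) = (q² z - w) e(w) e(z)` with
`e(z) = ∑ r, e r * z ^ (-r)`, written out as the family of equalities of the coefficients of
`z ^ (-r) * w ^ (-s)` for all integers `r`, `s`. -/
inductive Rel : FreeAlgebra K ℤ → FreeAlgebra K ℤ → Prop
  | quad (r s : ℤ) :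
      Rel (FreeAlgebra.ι K (r + 1) * FreeAlgebra.ι K s
            - q ^ 2 • (FreeAlgebra.ι K r * FreeAlgebra.ι K (s + 1)))
          (q ^ 2 • (FreeAlgebra.ι K s * FreeAlgebra.ι K (r + 1))
            - FreeAlgebra.ι K (s + 1) * FreeAlgebra.ι K r)

/-- The positive half `U_q^>(L sl₂)` of the quantum loop algebra of `sl₂`: the associative unital
`ℂ(q)`-algebra generated by `e r` (`r ∈ ℤ`) subject to the quadratic relation above. (There are
no Serre relations, as the Dynkin diagram has one vertex.) -/
abbrev UPos : Type := RingQuot Rel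

/-- The generator `e r`. -/
def e (r : ℤ) : UPos := RingQuot.mkAlgHom K Rel (FreeAlgebra.ι K r)

/-- The `q`-commutator `[a, b]_x = a b - x · b a`. -/
def qComm (x : K) (a b : UPos) : UPos := a * b - x • (b * a)

/-- The elements `M_{1,n} = e_{-n}`. -/
def M₁ (n : ℤ) : UPos := e (-n)

/-- The left-nested commutator
`[⋯[[M_{1,m}, M_{1,m+2}]_{𝔮²}, M_{1,m+4}]_{𝔮³}, ⋯, M_{1,m+2j}]_{𝔮^{j+1}}`, with `j` brackets. -/
def nested (m : ℤ) : ℕ → UPos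
  | 0 => M₁ m
  | j + 1 => qComm (qq ^ (j + 2)) (nested m j) (M₁ (m + 2 * ((j : ℤ) + 1)))

/-- The elements `M_{k,n}`: `M_{0,n} = 1`, and for `k ≥ 1`
`M_{k,n} = (-1)^{k(k-1)/2} / (1-𝔮)^{k-1} · [⋯[M_{1,n-k+1}, M_{1,n-k+3}]_{𝔮²}, ⋯, M_{1,n+k-1}]_{𝔮^k}`.
The second clause below is this formula for the index `k + 1`. -/
def M : ℕ → ℤ → UPos
  | 0, _ => 1
  | k + 1, n => ((-1 : K) ^ ((k + 1) * k / 2) / (1 - qq) ^ k) • nested (n - (k : ℤ)) k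

end

end QLoop

/-! Realise `UPos` as a shuffle algebra: an element of degree N is represented by a function of N
generic points, given by its values on finite sets, and a generator acts by inserting one more
point. Under this map `M k n` becomes a multiple of ∏_{i≠j} (z_i - 𝔮 z_j) · (∏ z_i)^{-(n+k-1)}.

For such functions, the products with `M₁ n` on either side are sums of residues of T^p / ∏ (T -
z_i)(T - 𝔮 z_i). With k+1 points and 0 ≤ p ≤ 2k there is no residue at 0 or ∞, which says that `M₁
n` and `M k m` 𝔮-commute when |m - n| ≤ k (`symb_M₁_mul_M`). At p = -1 the residue at 0 survives,
and it computes the bracket that defines the next M (`exists_symb_M_eq`).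

To return to `UPos`, the map must be injective on each homogeneous part (`eq_zero_of_symb_eq_zero`).
Symmetrised words span that part, and their images are a fixed nonzero constant times symmetrised
Laurent monomials. The theorem then follows from the case of `M₁` by building the smaller M out of
brackets (`M_mul_M`). -/

namespace QLoop

open Finset

/-! ### Residue identities at generic points. -/

section Residues

variable {F : Type*} [Field F]

/-- Nonzero points that are pairwise distinct, and distinct from their `Q`-multiples. -/
structure Generic (Q : F) (z : ℕ → F) : Prop where
  param_ne_zero : Q ≠ 0
  ne_zero : ∀ i, z i ≠ 0
  injective : Function.Injective z
  ne_mul : ∀ i j, z i ≠ Q * z j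

/-- The factor picked up by a letter at `z a` standing to the left of letters at `Y`. -/
def leftFactor (Q : F) (z : ℕ → F) (a : ℕ) (Y : Finset ℕ) : F :=
  ∏ b ∈ Y, (z b - Q * z a) / (z a - z b)

/-- The factor picked up by a letter at `z a` standing to the right of letters at `Y`. -/
def rightFactor (Q : F) (z : ℕ → F) (a : ℕ) (Y : Finset ℕ) : F :=
  ∏ b ∈ Y, (z a - Q * z b) / (z b - z a)

/-- The product of `z i - Q z j` over all ordered pairs of distinct points of `X`. -/
def wheelProd (Q : F) (z : ℕ → F) (X : Finset ℕ) : F :=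
  ∏ i ∈ X, ∏ j ∈ X.erase i, (z i - Q * z j)

/-- The residue, up to an elementary factor, of `1 / ∏ (T - z i) (T - Q z i)` at `T = z a`. -/
def resL (Q : F) (z : ℕ → F) (a : ℕ) (X : Finset ℕ) : F :=
  ∏ i ∈ X.erase a, ((z a - z i) * (z a - Q * z i))⁻¹

/-- The residue, up to an elementary factor, of `1 / ∏ (T - z i) (T - Q z i)` at `T = Q z a`. -/
def resR (Q : F) (z : ℕ → F) (a : ℕ) (X : Finset ℕ) : F :=
  ∏ i ∈ X.erase a, ((z i - z a) * (z i - Q * z a))⁻¹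

variable {Q : F} {z : ℕ → F}

theorem Generic.sub_ne_zero (h : Generic Q z) {i j : ℕ} (hij : i ≠ j) : z i - z j ≠ 0 :=
  _root_.sub_ne_zero.2 fun H => hij (h.injective H)

theorem Generic.sub_mul_ne_zero (h : Generic Q z) (i j : ℕ) : z i - Q * z j ≠ 0 :=
  _root_.sub_ne_zero.2 (h.ne_mul i j)

theorem Generic.one_sub_ne_zero (h : Generic Q z) : 1 - Q ≠ 0 := by
  intro H
  apply h.sub_mul_ne_zero 0 0
  rw [← sub_eq_zero.1 H]; ring

theorem wheelProd_eq_mul {a : ℕ} {X : Finset ℕ} (ha : a ∈ X) :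
    wheelProd Q z X = wheelProd Q z (X.erase a) *
      ∏ i ∈ X.erase a, ((z a - Q * z i) * (z i - Q * z a)) := by
  unfold wheelProd
  rw [← mul_prod_erase X _ ha, prod_mul_distrib]
  have : ∀ i ∈ X.erase a, ∏ j ∈ X.erase i, (z i - Q * z j) =
      (z i - Q * z a) * ∏ j ∈ (X.erase a).erase i, (z i - Q * z j) := by
    intro i hi
    have hia := ne_of_mem_erase hi
    rw [erase_right_comm, mul_prod_erase (X.erase i) (fun j => z i - Q * z j)
      (mem_erase.2 ⟨hia.symm, ha⟩)]
  rw [prod_congr rfl this, prod_mul_distrib]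
  ring

/-- Each i contributes (z_a - Q z_i)(z_i - Q z_a) to the larger product; the left factor supplies
the second of these, so a simple residue is what remains. -/
theorem leftFactor_mul_wheelProd (h : Generic Q z) {a : ℕ} {X : Finset ℕ} (ha : a ∈ X) :
    leftFactor Q z a (X.erase a) * wheelProd Q z (X.erase a) =
      wheelProd Q z X * resL Q z a X := by
  rw [wheelProd_eq_mul ha, mul_comm, mul_assoc]
  congr 1
  unfold leftFactor resL
  rw [← prod_mul_distrib]
  refine prod_congr rfl fun i hi => ?_
  have h1 := h.sub_ne_zero (ne_of_mem_erase hi).symm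
  have h2 := h.sub_mul_ne_zero a i
  rw [← div_eq_mul_inv, div_eq_div_iff h1 (mul_ne_zero h1 h2)]
  ring

theorem rightFactor_mul_wheelProd (h : Generic Q z) {a : ℕ} {X : Finset ℕ} (ha : a ∈ X) :
    rightFactor Q z a (X.erase a) * wheelProd Q z (X.erase a) =
      wheelProd Q z X * resR Q z a X := by
  rw [wheelProd_eq_mul ha, mul_comm, mul_assoc]
  congr 1
  unfold rightFactor resR
  rw [← prod_mul_distrib]
  refine prod_congr rfl fun i hi => ?_
  have h1 := h.sub_ne_zero (ne_of_mem_erase hi)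
  have h2 := h.sub_mul_ne_zero i a
  rw [← div_eq_mul_inv, div_eq_div_iff h1 (mul_ne_zero h1 h2)]
  ring

/-- Lagrange interpolation at the nodes `z i` and `Q z i`. -/
theorem coeff_eq_sum_residues (h : Generic Q z) (X : Finset ℕ) {P : Polynomial F}
    (hP : P.degree < (2 * #X : ℕ)) :
    P.coeff (2 * #X - 1) =
      ∑ a ∈ X, P.eval (z a) / ((1 - Q) * z a) * resL Q z a X
        - ∑ a ∈ X, P.eval (Q * z a) / ((1 - Q) * z a * Q ^ (#X - 1)) * resR Q z a X := by
  set v : ℕ ⊕ ℕ → F := Sum.elim z (fun i => Q * z i) with hv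
  have hinj : Set.InjOn v (X.disjSum X : Finset (ℕ ⊕ ℕ)) := by
    refine Function.Injective.injOn ?_
    refine Function.Injective.sumElim h.injective ?_ h.ne_mul
    exact fun i j hij => h.injective (mul_left_cancel₀ h.param_ne_zero hij)
  have hcard : #(X.disjSum X) = 2 * #X := by rw [card_disjSum, two_mul]
  have key := Lagrange.coeff_eq_sum hinj (P := P) (by rw [hcard]; exact hP)
  rw [hcard, sum_disjSum] at key
  rw [key, sub_eq_add_neg, ← sum_neg_distrib]
  have hq := h.one_sub_ne_zero
  congr 1 <;> refine sum_congr rfl fun a ha => ?_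
  · have he : (X.disjSum X).erase (Sum.inl a) = (X.erase a).disjSum X := by
      ext (i | i) <;> simp
    rw [he, prod_disjSum]
    simp only [hv, Sum.elim_inl, Sum.elim_inr]
    rw [← mul_prod_erase X _ ha]
    unfold resL
    rw [prod_inv_distrib, prod_mul_distrib]
    have h1 : ∏ i ∈ X.erase a, (z a - z i) ≠ 0 :=
      prod_ne_zero_iff.2 fun i hi => h.sub_ne_zero (ne_of_mem_erase hi).symm
    have h2 : ∏ i ∈ X.erase a, (z a - Q * z i) ≠ 0 :=
      prod_ne_zero_iff.2 fun i hi => h.sub_mul_ne_zero _ _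
    have h3 := h.ne_zero a
    have h4 : z a - Q * z a = (1 - Q) * z a := by ring
    rw [h4]
    field_simp
  · have he : (X.disjSum X).erase (Sum.inr a) = X.disjSum (X.erase a) := by
      ext (i | i) <;> simp
    rw [he, prod_disjSum]
    simp only [hv, Sum.elim_inl, Sum.elim_inr]
    rw [← mul_prod_erase X _ ha]
    unfold resR
    have h1 : ∏ i ∈ X.erase a, (z i - z a) ≠ 0 :=
      prod_ne_zero_iff.2 fun i hi => h.sub_ne_zero (ne_of_mem_erase hi)
    have h2 : ∏ i ∈ X.erase a, (z i - Q * z a) ≠ 0 :=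
      prod_ne_zero_iff.2 fun i hi => h.sub_mul_ne_zero _ _
    have h3 := h.ne_zero a
    have h5 := h.param_ne_zero
    -- This sign is the minus in front of the second sum; the signs of the other factors cancel in
    -- pairs.
    have e1 : Q * z a - z a = -((1 - Q) * z a) := by ring
    have e2 : (∏ i ∈ X.erase a, (Q * z a - z i)) * ∏ i ∈ X.erase a, (Q * z a - Q * z i) =
        Q ^ (#X - 1) * ((∏ i ∈ X.erase a, (z i - z a)) * ∏ i ∈ X.erase a, (z i - Q * z a)) := by
      rw [← card_erase_of_mem ha, ← prod_const, ← prod_mul_distrib, ← prod_mul_distrib,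
        ← prod_mul_distrib]
      exact prod_congr rfl fun i _ => by ring
    rw [prod_inv_distrib, prod_mul_distrib, mul_assoc, e2, e1]
    field_simp

/-- The coefficient of T^{2k+1} in T^p vanishes, so the finite residues of T^p / ∏ (T - z_i)(T - Q
z_i) sum to zero. -/
theorem sum_residues_pow (h : Generic Q z) {X : Finset ℕ} {k p : ℕ} (hX : #X = k + 1)
    (hp : p ≤ 2 * k) :
    ∑ a ∈ X, z a ^ ((p : ℤ) - 1) * (resL Q z a X - Q ^ ((p : ℤ) - k) * resR Q z a X) = 0 := by
  have key := coeff_eq_sum_residues h X (P := Polynomial.X ^ p) (by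
    rw [Polynomial.degree_X_pow, hX]; exact_mod_cast by omega)
  rw [Polynomial.coeff_X_pow, if_neg (by omega), ← sum_sub_distrib] at key
  have hq := h.one_sub_ne_zero
  have hQ := h.param_ne_zero
  have : ∑ a ∈ X, z a ^ ((p : ℤ) - 1) * (resL Q z a X - Q ^ ((p : ℤ) - k) * resR Q z a X)
      = (1 - Q) * 0 := by
    rw [key, mul_sum]
    refine sum_congr rfl fun a _ => ?_
    have h3 := h.ne_zero a
    simp only [Polynomial.eval_pow, Polynomial.eval_X]
    rw [zpow_sub_one₀ h3, zpow_natCast, zpow_sub₀ hQ, zpow_natCast, zpow_natCast, hX,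
      Nat.add_sub_cancel, mul_pow]
    field_simp
  rw [this, mul_zero]

/-- This is the case p = -1 of the previous sum, where the pole at T = 0 contributes the right-hand
side. -/
theorem sum_residues_inv_sq (h : Generic Q z) {X : Finset ℕ} {k : ℕ} (hX : #X = k + 1) :
    ∑ a ∈ X, z a ^ (-2 : ℤ) * (resR Q z a X - Q ^ (k + 1) * resL Q z a X) =
      (1 - Q) * (∏ a ∈ X, z a) ^ (-2 : ℤ) := by
  set N : Polynomial F := ∏ i ∈ X, ((Polynomial.X - Polynomial.C (z i)) *
    (Polynomial.X - Polynomial.C (Q * z i))) with hN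
  have hmon : N.Monic := Polynomial.monic_prod_of_monic _ _ fun i _ =>
    (Polynomial.monic_X_sub_C _).mul (Polynomial.monic_X_sub_C _)
  have hdeg : N.natDegree = 2 * #X := by
    rw [hN, Polynomial.natDegree_prod_of_monic _ _ fun i _ =>
      (Polynomial.monic_X_sub_C _).mul (Polynomial.monic_X_sub_C _)]
    rw [sum_congr rfl fun i _ => (Polynomial.monic_X_sub_C (z i)).natDegree_mul
      (Polynomial.monic_X_sub_C (Q * z i))]
    simp only [Polynomial.natDegree_X_sub_C, sum_const, smul_eq_mul]
    ring
  have hN0 : N.coeff 0 = Q ^ (k + 1) * (∏ a ∈ X, z a) ^ 2 := by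
    rw [Polynomial.coeff_zero_eq_eval_zero, hN, Polynomial.eval_prod, ← hX, ← prod_const,
      ← prod_pow, ← prod_mul_distrib]
    refine prod_congr rfl fun i _ => ?_
    simp; ring
  -- At the roots of `N`, the polynomial `N.divX` takes the values of -N(0)/T, so it replaces T^{-1}
  -- in the interpolation.
  have hev : ∀ s, N.eval s = 0 → N.divX.eval s * s = - N.coeff 0 := by
    intro s hs
    rw [← Polynomial.divX_mul_X_add N] at hs
    simp only [Polynomial.eval_add, Polynomial.eval_mul, Polynomial.eval_X, Polynomial.eval_C] at hs
    exact eq_neg_of_add_eq_zero_left hs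
  have hl : ∀ a ∈ X, N.eval (z a) = 0 := fun a ha => by
    rw [hN, Polynomial.eval_prod]; exact prod_eq_zero ha (by simp)
  have hr : ∀ a ∈ X, N.eval (Q * z a) = 0 := fun a ha => by
    rw [hN, Polynomial.eval_prod]; exact prod_eq_zero ha (by simp)
  have key := coeff_eq_sum_residues h X (P := N.divX) (by
    refine (Polynomial.degree_divX_lt hmon.ne_zero).trans_le ?_
    rw [← hdeg]; exact Polynomial.degree_le_natDegree)
  have hc : N.divX.coeff (2 * #X - 1) = 1 := by
    rw [Polynomial.coeff_divX, Nat.sub_add_cancel (by omega), ← hdeg]; exact hmon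
  have hq := h.one_sub_ne_zero
  have hQ := h.param_ne_zero
  have he : ∏ a ∈ X, z a ≠ 0 := prod_ne_zero_iff.2 fun a _ => h.ne_zero a
  have hc0 : N.coeff 0 ≠ 0 := by rw [hN0]; positivity
  rw [hc, ← sum_sub_distrib] at key
  have h2 : (1 - Q) * (∏ a ∈ X, z a) ^ (-2 : ℤ) = (1 - Q) * Q ^ (k + 1) / N.coeff 0 * 1 := by
    rw [hN0, zpow_neg]
    field_simp
  rw [h2]
  refine Eq.trans ?_ (congrArg (fun x => (1 - Q) * Q ^ (k + 1) / N.coeff 0 * x) key.symm)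
  rw [mul_sum]
  refine sum_congr rfl fun a ha => ?_
  have h3 := h.ne_zero a
  rw [eq_div_of_mul_eq h3 (hev _ (hl a ha)),
    eq_div_of_mul_eq (mul_ne_zero hQ h3) (hev _ (hr a ha)), hX, Nat.add_sub_cancel, zpow_neg]
  norm_cast
  field_simp
  ring

/-- Interpolate (N(QT) - N(T))/T at the z_i, where N = ∏ (T - z_i), and compare leading
coefficients. The sum is a quantum integer up to sign, whatever the points. -/
theorem sum_leftFactor (h : Generic Q z) {X : Finset ℕ} {k : ℕ} (hX : #X = k + 1) :
    (Q - 1) * ∑ a ∈ X, leftFactor Q z a (X.erase a) = (-1) ^ k * (Q ^ (k + 1) - 1) := by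
  set N : Polynomial F := ∏ i ∈ X, (Polynomial.X - Polynomial.C (z i)) with hN
  set N' : Polynomial F := N.comp (Polynomial.C Q * Polynomial.X) with hN'
  have hmon : N.Monic := Polynomial.monic_prod_of_monic _ _ fun i _ => Polynomial.monic_X_sub_C _
  have hdeg : N.natDegree = #X := by
    rw [hN, Polynomial.natDegree_prod_of_monic _ _ fun i _ => Polynomial.monic_X_sub_C _]
    simp
  have hcoef : N'.coeff #X = Q ^ (k + 1) := by
    rw [hN', Polynomial.comp_C_mul_X_coeff, ← hdeg, hmon.coeff_natDegree, hdeg, hX, one_mul]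
  have hdeg' : N'.natDegree ≤ #X := by
    rw [hN']
    refine Polynomial.natDegree_comp_le.trans ?_
    refine (Nat.mul_le_mul hdeg.le (?_ : _ ≤ 1)).trans (mul_one _).le
    exact (Polynomial.natDegree_C_mul_le _ _).trans Polynomial.natDegree_X_le
  have hzero : N'.coeff 0 = N.coeff 0 := by
    rw [hN', Polynomial.comp_C_mul_X_coeff]; simp
  have hlt : ∀ R : Polynomial F, R.natDegree ≤ #X → R.divX.degree < #X := by
    intro R hR
    refine (Polynomial.degree_le_natDegree).trans_lt ?_
    rw [Polynomial.natDegree_divX_eq_natDegree_tsub_one]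
    exact_mod_cast by omega
  have key := Lagrange.coeff_eq_sum (s := X) (v := z) h.injective.injOn (P := N'.divX - N.divX)
    ((Polynomial.degree_sub_le _ _).trans_lt (max_lt (hlt _ hdeg') (hlt _ hdeg.le)))
  rw [Polynomial.coeff_sub, Polynomial.coeff_divX, Polynomial.coeff_divX,
    Nat.sub_add_cancel (by omega), hcoef, ← hdeg, hmon.coeff_natDegree] at key
  rw [key, mul_sum, mul_sum]
  refine sum_congr rfl fun a ha => ?_
  have h3 := h.ne_zero a
  have hev : (N'.divX - N.divX).eval (z a) * z a = (Q - 1) * z a *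
      ∏ i ∈ X.erase a, (Q * z a - z i) := by
    have e1 : N.eval (z a) = 0 := by
      rw [hN, Polynomial.eval_prod]; exact prod_eq_zero ha (by simp)
    have e2 : N'.eval (z a) = (Q - 1) * z a * ∏ i ∈ X.erase a, (Q * z a - z i) := by
      rw [hN', Polynomial.eval_comp, hN, Polynomial.eval_prod, ← mul_prod_erase X _ ha]
      simp only [Polynomial.eval_sub, Polynomial.eval_mul, Polynomial.eval_X, Polynomial.eval_C]
      ring
    rw [← e2, ← sub_zero (N'.eval (z a)), ← e1]
    conv_rhs => rw [← Polynomial.divX_mul_X_add N, ← Polynomial.divX_mul_X_add N', hzero]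
    simp only [Polynomial.eval_add, Polynomial.eval_mul, Polynomial.eval_X, Polynomial.eval_C,
      Polynomial.eval_sub]
    ring
  have hev' : (N'.divX - N.divX).eval (z a) = (Q - 1) * ∏ i ∈ X.erase a, (Q * z a - z i) := by
    apply mul_right_cancel₀ h3; rw [hev]; ring
  rw [hev', leftFactor, prod_div_distrib, mul_div_assoc, mul_left_comm]
  congr 1
  rw [mul_div_assoc', ← (by rw [card_erase_of_mem ha, hX]; rfl : #(X.erase a) = k), ← prod_const,
    ← prod_mul_distrib]
  congr 1
  exact prod_congr rfl fun i _ => by ring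

theorem sum_erase_comm {R : Type*} [AddCommMonoid R] (X : Finset ℕ) (f : ℕ → ℕ → R) :
    ∑ a ∈ X, ∑ b ∈ X.erase a, f a b = ∑ b ∈ X, ∑ a ∈ X.erase b, f a b :=
  sum_comm' fun a b => by simp only [mem_erase]; tauto

theorem leftFactor_erase {Q : F} {z : ℕ → F} {a b : ℕ} {Y : Finset ℕ} (hb : b ∈ Y) :
    leftFactor Q z a Y = (z b - Q * z a) / (z a - z b) * leftFactor Q z a (Y.erase b) :=
  (mul_prod_erase Y _ hb).symm

theorem rightFactor_erase {Q : F} {z : ℕ → F} {a b : ℕ} {Y : Finset ℕ} (hb : b ∈ Y) :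
    rightFactor Q z a Y = (z a - Q * z b) / (z b - z a) * rightFactor Q z a (Y.erase b) :=
  (mul_prod_erase Y _ hb).symm

end Residues

/-! ### The shuffle representation. -/

section Representation

variable {F : Type*} [Field F] [Algebra K F]

/-- Insertion of a letter `e r` on the left, on functions of finite sets of points. -/
noncomputable def leftOp (z : ℕ → F) (r : ℤ) : (Finset ℕ → F) →ₗ[K] (Finset ℕ → F) where
  toFun B X := ∑ a ∈ X, z a ^ r * leftFactor (algebraMap K F qq) z a (X.erase a) * B (X.erase a)
  map_add' B C := by
    ext X; simp only [Pi.add_apply, mul_add, sum_add_distrib]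
  map_smul' c B := by
    ext X; simp only [Pi.smul_apply, mul_smul_comm, smul_sum, RingHom.id_apply]

/-- Insertion of a letter `e r` on the right, on functions of finite sets of points. -/
noncomputable def rightOp (z : ℕ → F) (r : ℤ) : (Finset ℕ → F) →ₗ[K] (Finset ℕ → F) where
  toFun B X := ∑ a ∈ X, z a ^ r * rightFactor (algebraMap K F qq) z a (X.erase a) * B (X.erase a)
  map_add' B C := by
    ext X; simp only [Pi.add_apply, mul_add, sum_add_distrib]
  map_smul' c B := by
    ext X; simp only [Pi.smul_apply, mul_smul_comm, smul_sum, RingHom.id_apply]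

theorem leftOp_apply (z : ℕ → F) (r : ℤ) (B : Finset ℕ → F) (X : Finset ℕ) :
    leftOp z r B X =
      ∑ a ∈ X, z a ^ r * leftFactor (algebraMap K F qq) z a (X.erase a) * B (X.erase a) := rfl

theorem rightOp_apply (z : ℕ → F) (r : ℤ) (B : Finset ℕ → F) (X : Finset ℕ) :
    rightOp z r B X =
      ∑ a ∈ X, z a ^ r * rightFactor (algebraMap K F qq) z a (X.erase a) * B (X.erase a) := rfl

/-- Both orders give the pair a, b the same factor (z_b - Q z_a)/(z_a - z_b). -/
theorem leftOp_rightOp_comm (z : ℕ → F) (r s : ℤ) (B : Finset ℕ → F) :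
    leftOp z r (rightOp z s B) = rightOp z s (leftOp z r B) := by
  ext X
  simp only [leftOp_apply, rightOp_apply, mul_sum]
  rw [sum_erase_comm]
  refine sum_congr rfl fun b hb => sum_congr rfl fun a ha => ?_
  have hab := ne_of_mem_erase ha
  rw [leftFactor_erase (mem_erase.2 ⟨hab.symm, hb⟩), rightFactor_erase ha, erase_right_comm]
  ring

theorem leftOp_leftOp_apply (z : ℕ → F) (r s : ℤ) (B : Finset ℕ → F) (X : Finset ℕ) :
    leftOp z r (leftOp z s B) X = ∑ a ∈ X, ∑ b ∈ X.erase a, z a ^ r * z b ^ s *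
      (leftFactor (algebraMap K F qq) z a (X.erase a) *
        leftFactor (algebraMap K F qq) z b ((X.erase a).erase b) * B ((X.erase a).erase b)) := by
  simp only [leftOp_apply, mul_sum]
  refine sum_congr rfl fun b hb => sum_congr rfl fun a ha => ?_
  ring

/-- The difference of the two sides sums (z_a - Q z_b)(z_b - Q z_a)/(z_a - z_b) times terms
symmetric in a and b. The summand is antisymmetric, so the sum over ordered pairs vanishes. -/
theorem leftOp_quad [CharZero F] {z : ℕ → F} (h : Generic (algebraMap K F qq) z) (r s : ℤ)
    (B : Finset ℕ → F) :
    leftOp z (r + 1) (leftOp z s B) - qq • leftOp z r (leftOp z (s + 1) B) =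
      qq • leftOp z s (leftOp z (r + 1) B) - leftOp z (s + 1) (leftOp z r B) := by
  rw [← sub_eq_zero]
  ext X
  set Q := algebraMap K F qq with hQ
  set G : ℕ → ℕ → F := fun a b => leftFactor Q z a (X.erase a) *
    leftFactor Q z b ((X.erase a).erase b) * B ((X.erase a).erase b) with hG
  set H : ℕ → ℕ → F := fun a b =>
    (z a - Q * z b) * (z a ^ r * z b ^ s + z a ^ s * z b ^ r) * G a b with hH
  have hanti : ∑ a ∈ X, ∑ b ∈ X.erase a, H a b = - ∑ a ∈ X, ∑ b ∈ X.erase a, H a b := by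
    conv_lhs => rw [sum_erase_comm]
    rw [← sum_neg_distrib]
    refine sum_congr rfl fun b hb => ?_
    rw [← sum_neg_distrib]
    refine sum_congr rfl fun a ha => ?_
    have hab := ne_of_mem_erase ha
    have e : (z b - Q * z a) / (z a - z b) = -((z b - Q * z a) / (z b - z a)) := by
      rw [← neg_sub (z b), div_neg]
    simp only [hH, hG]
    rw [leftFactor_erase (a := a) (mem_erase.2 ⟨hab.symm, hb⟩), leftFactor_erase (a := b) ha, e,
      erase_right_comm]
    ring
  have hz : ∑ a ∈ X, ∑ b ∈ X.erase a, H a b = 0 := self_eq_neg.1 hanti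
  rw [Pi.zero_apply, ← hz]
  simp only [Pi.sub_apply, Pi.smul_apply, leftOp_leftOp_apply]
  simp only [Algebra.smul_def, ← hQ, mul_sum, ← sum_sub_distrib]
  refine sum_congr rfl fun b hb => sum_congr rfl fun a ha => ?_
  simp only [hH, hG, zpow_add_one₀ (h.ne_zero _)]
  ring

/-- The action of `UPos` on functions of finite sets of points. -/
noncomputable def rep [CharZero F] {z : ℕ → F} (h : Generic (algebraMap K F qq) z) :
    UPos →ₐ[K] Module.End K (Finset ℕ → F) :=
  RingQuot.liftAlgHom K ⟨FreeAlgebra.lift K (leftOp z), by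
    rintro _ _ ⟨r, s⟩
    simp only [map_sub, map_mul, map_smul, FreeAlgebra.lift_ι_apply]
    exact LinearMap.ext fun B => leftOp_quad h r s B⟩

variable [CharZero F] {z : ℕ → F} (h : Generic (algebraMap K F qq) z)

theorem rep_e (r : ℤ) : rep h (e r) = leftOp z r := by
  rw [rep, e, RingQuot.liftAlgHom_mkAlgHom_apply, FreeAlgebra.lift_ι_apply]

/-- The function supported at the empty set. -/
def vacuum : Finset ℕ → F := fun X => if X = ∅ then 1 else 0

/-- The function representing an element of `UPos`. -/
noncomputable def symb : UPos →ₗ[K] (Finset ℕ → F) :=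
  (LinearMap.applyₗ (vacuum : Finset ℕ → F)).comp (rep h).toLinearMap

theorem symb_apply (u : UPos) : symb h u = rep h u vacuum := rfl

theorem symb_one : symb h 1 = vacuum := by simp [symb_apply]

theorem symb_e_mul (r : ℤ) (u : UPos) : symb h (e r * u) = leftOp z r (symb h u) := by
  simp [symb_apply, rep_e]

/-- Only one-point sets contribute, and there both factors are empty products. -/
theorem leftOp_vacuum (r : ℤ) : leftOp z r vacuum = rightOp z r vacuum := by
  ext X
  rw [leftOp_apply, rightOp_apply]
  refine sum_congr rfl fun a ha => ?_
  by_cases hX : X.erase a = ∅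
  · rw [hX]; simp [leftFactor, rightFactor]
  · simp [vacuum, hX]

/-- `UPos` is generated by the `e r`. -/
theorem UPos.induction {p : UPos → Prop} (smul_one : ∀ c : K, p (algebraMap K UPos c))
    (he : ∀ r, p (e r)) (add : ∀ u v, p u → p v → p (u + v)) (mul : ∀ u v, p u → p v → p (u * v))
    (u : UPos) : p u := by
  obtain ⟨x, rfl⟩ := RingQuot.mkAlgHom_surjective K Rel u
  induction x using FreeAlgebra.induction with
  | grade0 c => rw [AlgHom.commutes]; exact smul_one c
  | grade1 r => exact he r
  | mul a b ha hb => rw [map_mul]; exact mul _ _ ha hb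
  | add a b ha hb => rw [map_add]; exact add _ _ ha hb

theorem rep_rightOp (u : UPos) (s : ℤ) (B : Finset ℕ → F) :
    rep h u (rightOp z s B) = rightOp z s (rep h u B) := by
  induction u using UPos.induction generalizing B with
  | smul_one c => simp [Module.algebraMap_end_apply]
  | he r => rw [rep_e, leftOp_rightOp_comm]
  | add u v hu hv => simp [hu, hv]
  | mul u v hu hv => simp [hu, hv]

/-- On the vacuum, left and right insertion agree; the right insertion then commutes past the action
of `u`. -/
theorem symb_mul_e (u : UPos) (r : ℤ) : symb h (u * e r) = rightOp z r (symb h u) := by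
  rw [symb_apply, map_mul, Module.End.mul_apply, rep_e, leftOp_vacuum, rep_rightOp, symb_apply]

end Representation

theorem qq_pow_ne_one {n : ℕ} (hn : n ≠ 0) : qq ^ n ≠ 1 := by
  intro h
  have : (Polynomial.X ^ (2 * n) : Polynomial ℂ) = 1 := by
    apply RatFunc.algebraMap_injective ℂ
    rw [map_pow, RatFunc.algebraMap_X, pow_mul, map_one]
    exact h
  have h2 := congrArg Polynomial.natDegree this
  rw [Polynomial.natDegree_X_pow, Polynomial.natDegree_one] at h2
  omega

theorem one_sub_qq_ne_zero : (1 : K) - qq ≠ 0 :=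
  sub_ne_zero.2 fun h => qq_pow_ne_one one_ne_zero (by rw [pow_one, ← h])

theorem qq_ne_zero : qq ≠ 0 := pow_ne_zero _ RatFunc.X_ne_zero

/-- `M_{k+1,n}` is proportional to `[M_{k,n-1}, M_{1,n+k}]_{𝔮^{k+1}}`. -/
theorem exists_M_succ_eq (k : ℕ) (n : ℤ) :
    ∃ c : K, M (k + 1) n = c • qComm (qq ^ (k + 1)) (M k (n - 1)) (M₁ (n + k)) := by
  rcases k with _ | k
  · refine ⟨(1 - qq)⁻¹, ?_⟩
    have h : qComm (qq ^ (0 + 1)) (M 0 (n - 1)) (M₁ (n + (0 : ℕ))) = (1 - qq) • M₁ n := by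
      simpa [qComm, M] using (sub_smul (1 : K) qq (M₁ n)).symm
    rw [h, smul_smul, inv_mul_cancel₀ one_sub_qq_ne_zero, one_smul]
    simp [M, nested]
  · set s : K := (-1 : K) ^ ((k + 1) * k / 2) / (1 - qq) ^ k with hs
    have hs0 : s ≠ 0 := div_ne_zero (pow_ne_zero _ (neg_ne_zero.2 one_ne_zero))
      (pow_ne_zero _ one_sub_qq_ne_zero)
    set t : K := (-1 : K) ^ ((k + 1 + 1) * (k + 1) / 2) / (1 - qq) ^ (k + 1) with ht
    refine ⟨t / s, ?_⟩
    have e1 : M (k + 1) (n - 1) = s • nested (n - ((k + 1 : ℕ) : ℤ)) k := by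
      rw [M, ← hs]; congr 2; push_cast; ring
    have e2 : M (k + 1 + 1) n = t • qComm (qq ^ (k + 2)) (nested (n - ((k + 1 : ℕ) : ℤ)) k)
        (M₁ (n + ((k + 1 : ℕ) : ℤ))) := by
      rw [M, ← ht, nested]; congr 3; push_cast; ring
    rw [e1, e2]
    simp only [qComm, smul_mul_assoc, mul_smul_comm, smul_sub, smul_smul]
    congr 2
    · field_simp
    · field_simp

/-! ### The functions representing the M's. -/

section Symbols

variable {F : Type*} [Field F] [Algebra K F]

/-- The function representing `M_{k,n}`, up to a scalar. -/
noncomputable def mSymb (z : ℕ → F) (k : ℕ) (n : ℤ) (X : Finset ℕ) : F :=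
  if #X = k then wheelProd (algebraMap K F qq) z X * (∏ i ∈ X, z i) ^ (-(n + k - 1)) else 0

variable {z : ℕ → F}

theorem leftFactor_mul_mSymb (h : Generic (algebraMap K F qq) z) {k : ℕ} (n : ℤ) {X : Finset ℕ}
    (hX : #X = k + 1) {a : ℕ} (ha : a ∈ X) :
    leftFactor (algebraMap K F qq) z a (X.erase a) * mSymb z k n (X.erase a) =
      wheelProd (algebraMap K F qq) z X * (∏ i ∈ X, z i) ^ (-(n + k - 1)) *
        (z a ^ (n + k - 1) * resL (algebraMap K F qq) z a X) := by
  rw [mSymb, if_pos (by rw [card_erase_of_mem ha, hX]; rfl), ← mul_assoc,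
    leftFactor_mul_wheelProd h ha, ← mul_prod_erase X _ ha, mul_zpow, zpow_neg (z a)]
  have := zpow_ne_zero (n + k - 1) (h.ne_zero a)
  field_simp

theorem rightFactor_mul_mSymb (h : Generic (algebraMap K F qq) z) {k : ℕ} (n : ℤ) {X : Finset ℕ}
    (hX : #X = k + 1) {a : ℕ} (ha : a ∈ X) :
    rightFactor (algebraMap K F qq) z a (X.erase a) * mSymb z k n (X.erase a) =
      wheelProd (algebraMap K F qq) z X * (∏ i ∈ X, z i) ^ (-(n + k - 1)) *
        (z a ^ (n + k - 1) * resR (algebraMap K F qq) z a X) := by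
  rw [mSymb, if_pos (by rw [card_erase_of_mem ha, hX]; rfl), ← mul_assoc,
    rightFactor_mul_wheelProd h ha, ← mul_prod_erase X _ ha, mul_zpow, zpow_neg (z a)]
  have := zpow_ne_zero (n + k - 1) (h.ne_zero a)
  field_simp

theorem leftOp_mSymb (h : Generic (algebraMap K F qq) z) (k : ℕ) (n r : ℤ) (X : Finset ℕ) :
    leftOp z r (mSymb z k n) X = if #X = k + 1 then
      wheelProd (algebraMap K F qq) z X * (∏ i ∈ X, z i) ^ (-(n + k - 1)) *
        ∑ a ∈ X, z a ^ (r + (n + k - 1)) * resL (algebraMap K F qq) z a X else 0 := by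
  rw [leftOp_apply]
  split_ifs with hX
  · rw [mul_sum]
    refine sum_congr rfl fun a ha => ?_
    rw [mul_assoc, leftFactor_mul_mSymb h n hX ha, zpow_add₀ (h.ne_zero a)]
    ring
  · refine sum_eq_zero fun a ha => ?_
    have := card_erase_add_one ha
    rw [mSymb, if_neg (by omega), mul_zero]

theorem rightOp_mSymb (h : Generic (algebraMap K F qq) z) (k : ℕ) (n r : ℤ) (X : Finset ℕ) :
    rightOp z r (mSymb z k n) X = if #X = k + 1 then
      wheelProd (algebraMap K F qq) z X * (∏ i ∈ X, z i) ^ (-(n + k - 1)) *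
        ∑ a ∈ X, z a ^ (r + (n + k - 1)) * resR (algebraMap K F qq) z a X else 0 := by
  rw [rightOp_apply]
  split_ifs with hX
  · rw [mul_sum]
    refine sum_congr rfl fun a ha => ?_
    rw [mul_assoc, rightFactor_mul_mSymb h n hX ha, zpow_add₀ (h.ne_zero a)]
    ring
  · refine sum_eq_zero fun a ha => ?_
    have := card_erase_add_one ha
    rw [mSymb, if_neg (by omega), mul_zero]

variable [CharZero F] (h : Generic (algebraMap K F qq) z)

/-- The scalar need not be known, since 𝔮-commutation is unaffected by rescaling. In the inductive
step the index gap of the bracket is -(k+1), one past the commuting range, which is the case of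
`sum_residues_inv_sq`. -/
theorem exists_symb_M_eq (k : ℕ) (n : ℤ) : ∃ c : K, symb h (M k n) = c • mSymb z k n := by
  induction k generalizing n with
  | zero =>
    refine ⟨1, ?_⟩
    rw [one_smul, M, symb_one]
    ext X
    by_cases hX : X = ∅ <;> simp [vacuum, mSymb, hX, wheelProd]
  | succ k ih =>
    obtain ⟨c, hc⟩ := ih (n - 1)
    obtain ⟨d, hd⟩ := exists_M_succ_eq k n
    refine ⟨d * c * (1 - qq), ?_⟩
    rw [hd, qComm, M₁, map_smul, map_sub, map_smul, symb_mul_e, symb_e_mul, hc, map_smul, map_smul,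
      smul_comm _ c, ← smul_sub, smul_smul, mul_smul (d * c)]
    congr 1
    ext X
    rw [Pi.sub_apply, Pi.smul_apply, Pi.smul_apply, leftOp_mSymb h, rightOp_mSymb h, mSymb,
      Algebra.smul_def, Algebra.smul_def, map_pow, map_sub, map_one]
    push_cast
    split_ifs with hX
    · have key := sum_residues_inv_sq h hX
      have he : ∏ i ∈ X, z i ≠ 0 := prod_ne_zero_iff.2 fun a _ => h.ne_zero a
      have e1 : -(n + k) + (n - 1 + k - 1) = (-2 : ℤ) := by ring
      have e2 : -(n + (k + 1) - 1 : ℤ) = -(n - 1 + k - 1) + -2 := by ring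
      have key' : (∑ a ∈ X, z a ^ (-2 : ℤ) * resR (algebraMap K F qq) z a X) -
          algebraMap K F qq ^ (k + 1) * ∑ a ∈ X, z a ^ (-2 : ℤ) * resL (algebraMap K F qq) z a X =
          (1 - algebraMap K F qq) * (∏ a ∈ X, z a) ^ (-2 : ℤ) := by
        rw [← key, mul_sum, ← sum_sub_distrib]
        exact sum_congr rfl fun a _ => by ring
      rw [e1, e2, zpow_add₀ he]
      linear_combination wheelProd (algebraMap K F qq) z X *
        (∏ i ∈ X, z i) ^ (-(n - 1 + k - 1) : ℤ) * key'
    · simp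

/-- In the range `|m - n| ≤ k`, the elements `M_{1,n}` and `M_{k,m}` have `𝔮`-commuting symbols. -/
theorem symb_M₁_mul_M (k : ℕ) {n m : ℤ} (hnm : |m - n| ≤ k) :
    symb h (M₁ n * M k m) = symb h (qq ^ (m - n) • (M k m * M₁ n)) := by
  obtain ⟨c, hc⟩ := exists_symb_M_eq h k m
  rw [map_smul, M₁, symb_mul_e, symb_e_mul, hc, map_smul, map_smul, smul_comm _ c]
  congr 1
  ext X
  rw [Pi.smul_apply, leftOp_mSymb h, rightOp_mSymb h, Algebra.smul_def, map_zpow₀]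
  split_ifs with hX
  · rw [abs_le] at hnm
    -- The shift by k turns -k ≤ m - n ≤ k into the range 0 ≤ p ≤ 2k of vanishing residues.
    obtain ⟨p, hp⟩ := Int.eq_ofNat_of_zero_le (a := m - n + k) (by omega)
    have key := sum_residues_pow h hX (p := p) (by omega)
    rw [← hp] at key
    rw [mul_left_comm, ← sub_eq_zero, ← mul_sub, mul_sum, ← sum_sub_distrib]
    convert mul_zero _ using 2
    rw [← key]
    refine sum_congr rfl fun a _ => ?_
    rw [show m - n + k - k = m - n by ring, show -n + (m + k - 1) = m - n + k - 1 by ring]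
    ring
  · simp

end Symbols

/-! ### Symmetrised words span each degree. -/

/-- The product `e r₁ ⋯ e rₙ`. -/
noncomputable def word (l : List ℤ) : UPos := (l.map e).prod

theorem word_nil : word [] = 1 := rfl

theorem word_cons (r : ℤ) (l : List ℤ) : word (r :: l) = e r * word l := List.prod_cons

theorem word_append (l l' : List ℤ) : word (l ++ l') = word l * word l' := by
  rw [word, List.map_append, List.prod_append]; rfl

/-- The sum of the squares of the letters. -/
def normSq (l : List ℤ) : ℕ := (l.map fun r => r.natAbs ^ 2).sum

theorem normSq_cons (r : ℤ) (l : List ℤ) : normSq (r :: l) = r.natAbs ^ 2 + normSq l :=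
  List.sum_cons

theorem normSq_perm {l l' : List ℤ} (h : l.Perm l') : normSq l = normSq l' :=
  (h.map _).sum_eq

/-- The span of the words of length `N` and `normSq` less than `s`. -/
noncomputable def lowerSpan (N s : ℕ) : Submodule K UPos :=
  Submodule.span K (word '' {l | l.length = N ∧ normSq l < s})

theorem word_mem_lowerSpan {N s : ℕ} {l : List ℤ} (hl : l.length = N) (hs : normSq l < s) :
    word l ∈ lowerSpan N s :=
  Submodule.subset_span ⟨l, ⟨hl, hs⟩, rfl⟩

theorem e_mul_mem_lowerSpan {N s : ℕ} (r : ℤ) {u : UPos} (hu : u ∈ lowerSpan N s) :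
    e r * u ∈ lowerSpan (N + 1) (r.natAbs ^ 2 + s) := by
  induction hu using Submodule.span_induction with
  | mem x hx =>
    obtain ⟨l, ⟨hl, hs⟩, rfl⟩ := hx
    rw [← word_cons]
    exact word_mem_lowerSpan (by simp [hl]) (by rw [normSq_cons]; omega)
  | zero => rw [mul_zero]; exact zero_mem _
  | add x y _ _ hx hy => rw [mul_add]; exact add_mem hx hy
  | smul c x _ hx => rw [mul_smul_comm]; exact Submodule.smul_mem _ _ hx

theorem e_quad (r s : ℤ) : e (r + 1) * e s - qq • (e r * e (s + 1)) =
    qq • (e s * e (r + 1)) - e (s + 1) * e r := by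
  have := RingQuot.mkAlgHom_rel K (Rel.quad r s)
  simp only [map_sub, map_mul, map_smul] at this
  exact this

/-- Exchanging the first two letters multiplies a word by a power of `𝔮`, up to lower words. -/
theorem word_sub_swap_mem_of_lt {a b : ℤ} (hab : b < a) (l : List ℤ) :
    word (a :: b :: l) - qq • word (b :: a :: l) ∈
      lowerSpan (l.length + 2) (normSq (a :: b :: l)) := by
  have hq := e_quad (a - 1) b
  rw [sub_add_cancel] at hq
  simp only [word_cons, ← mul_assoc]
  rw [← smul_mul_assoc, ← sub_mul]
  rcases eq_or_lt_of_le (show b + 1 ≤ a by omega) with h | h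
  · subst h
    rw [add_sub_cancel_right] at hq
    -- For adjacent indices the relation reads x = -x.
    have h2 : (2 : K) • (e (b + 1) * e b - qq • (e b * e (b + 1))) = 0 := by
      rw [two_smul]
      nth_rewrite 1 [hq]
      abel
    rw [(smul_eq_zero.1 h2).resolve_left two_ne_zero, zero_mul]
    exact zero_mem _
  · have e1 : e a * e b - qq • (e b * e a) =
        qq • (e (a - 1) * e (b + 1)) - e (b + 1) * e (a - 1) := by
      rw [sub_eq_sub_iff_add_eq_add] at hq ⊢
      rw [hq]; abel
    rw [e1, sub_mul, smul_mul_assoc, mul_assoc, mul_assoc, ← word_cons, ← word_cons, ← word_cons,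
      ← word_cons]
    -- Moving the two indices towards each other lowers the sum of squares by 2(a - b - 1).
    have hlt : (a - 1).natAbs ^ 2 + (b + 1).natAbs ^ 2 < a.natAbs ^ 2 + b.natAbs ^ 2 := by
      zify
      simp only [sq_abs]
      nlinarith
    refine sub_mem (Submodule.smul_mem _ _ ?_) ?_ <;>
      refine word_mem_lowerSpan (by simp) ?_ <;>
      simp only [normSq_cons] <;> omega

theorem exists_word_swap (a b : ℤ) (l : List ℤ) : ∃ k : ℤ,
    word (a :: b :: l) - qq ^ k • word (b :: a :: l) ∈
      lowerSpan (l.length + 2) (normSq (a :: b :: l)) := by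
  rcases lt_trichotomy a b with h | rfl | h
  · refine ⟨-1, ?_⟩
    have := Submodule.smul_mem _ (-qq⁻¹) (word_sub_swap_mem_of_lt h l)
    rw [smul_sub, smul_smul, neg_mul, inv_mul_cancel₀ qq_ne_zero, neg_smul, neg_smul, one_smul,
      sub_neg_eq_add, neg_add_eq_sub] at this
    rw [zpow_neg_one, normSq_perm (List.Perm.swap b a l)]
    exact this
  · exact ⟨0, by simp⟩
  · exact ⟨1, by rw [zpow_one]; exact word_sub_swap_mem_of_lt h l⟩

theorem exists_word_perm {l l' : List ℤ} (h : l.Perm l') : ∃ k : ℤ,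
    word l - qq ^ k • word l' ∈ lowerSpan l.length (normSq l) := by
  induction h with
  | nil => exact ⟨0, by simp⟩
  | cons x _ ih =>
    obtain ⟨k, hk⟩ := ih
    refine ⟨k, ?_⟩
    have := e_mul_mem_lowerSpan x hk
    rw [mul_sub, mul_smul_comm, ← word_cons, ← word_cons, ← normSq_cons] at this
    exact this
  | swap x y l => exact exists_word_swap y x l
  | trans h1 _ ih1 ih2 =>
    obtain ⟨k1, hk1⟩ := ih1
    obtain ⟨k2, hk2⟩ := ih2
    refine ⟨k1 + k2, ?_⟩
    rw [← h1.length_eq, ← normSq_perm h1] at hk2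
    have := add_mem hk1 (Submodule.smul_mem _ (qq ^ k1) hk2)
    rwa [smul_sub, smul_smul, ← zpow_add₀ qq_ne_zero, sub_add_sub_cancel] at this

theorem sum_qq_zpow_ne_zero {ι : Type*} {s : Finset ι} (hs : s.Nonempty) (k : ι → ℤ) :
    ∑ i ∈ s, qq ^ k i ≠ 0 := by
  intro h
  obtain ⟨m, hm⟩ : ∃ m : ℕ, ∀ i ∈ s, 0 ≤ k i + m := by
    refine ⟨s.sup fun i => (k i).natAbs, fun i hi => ?_⟩
    have := le_sup (f := fun i => (k i).natAbs) hi
    omega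
  set P : Polynomial ℂ := ∑ i ∈ s, Polynomial.X ^ (2 * (k i + m).toNat) with hP
  have h0 : P = 0 := by
    apply RatFunc.algebraMap_injective ℂ
    rw [map_zero, ← mul_zero (qq ^ m), ← h, mul_sum, hP, map_sum]
    refine sum_congr rfl fun i hi => ?_
    rw [map_pow, RatFunc.algebraMap_X, pow_mul]
    change qq ^ _ = _
    rw [← zpow_natCast, ← zpow_natCast, ← zpow_add₀ qq_ne_zero, Int.toNat_of_nonneg (hm i hi),
      add_comm]
  -- At q = 1 the sum becomes the number of its terms.
  have h1 := congrArg (Polynomial.eval 1) h0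
  rw [hP, Polynomial.eval_finsetSum] at h1
  simp at h1
  exact hs.ne_empty h1

/-- The sum of the words obtained by permuting the letters. -/
noncomputable def symWord {N : ℕ} (r : Fin N → ℤ) : UPos :=
  ∑ σ : Equiv.Perm (Fin N), word (List.ofFn (r ∘ σ))

/-- Modulo lower words, a symmetrised word is a sum of powers of 𝔮 times the original word. That sum
is nonzero, so the word can be solved for by induction on `normSq`. -/
theorem word_ofFn_mem_span {N : ℕ} (r : Fin N → ℤ) :
    word (List.ofFn r) ∈ Submodule.span K (Set.range (symWord (N := N))) := by
  induction hs : normSq (List.ofFn r) using Nat.strong_induction_on generalizing r with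
  | _ s ih =>
    have hlow : lowerSpan N s ≤ Submodule.span K (Set.range (symWord (N := N))) := by
      refine Submodule.span_le.2 ?_
      rintro _ ⟨l, ⟨rfl, hl⟩, rfl⟩
      have := ih _ (by rwa [List.ofFn_get]) l.get rfl
      rwa [List.ofFn_get] at this
    choose k hk using fun σ : Equiv.Perm (Fin N) => exists_word_perm (σ.ofFn_comp_perm r)
    have hmem : symWord r - (∑ σ, qq ^ k σ) • word (List.ofFn r) ∈ lowerSpan N s := by
      rw [symWord, sum_smul, ← sum_sub_distrib]
      refine sum_mem fun σ _ => ?_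
      have := hk σ
      rwa [List.length_ofFn, normSq_perm (σ.ofFn_comp_perm r), hs] at this
    have h1 := sub_mem (Submodule.subset_span (Set.mem_range_self r)) (hlow hmem)
    rw [sub_sub_cancel] at h1
    exact (Submodule.smul_mem_iff _ (sum_qq_zpow_ne_zero univ_nonempty k)).1 h1

/-- The homogeneous elements of degree `N`. -/
noncomputable def homogeneous (N : ℕ) : Submodule K UPos :=
  Submodule.span K (word '' {l | l.length = N})

theorem homogeneous_le_span (N : ℕ) :
    homogeneous N ≤ Submodule.span K (Set.range (symWord (N := N))) := by
  refine Submodule.span_le.2 ?_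
  rintro _ ⟨l, rfl, rfl⟩
  have := word_ofFn_mem_span l.get
  rwa [List.ofFn_get] at this

theorem homogeneous_mul {m n : ℕ} {u v : UPos} (hu : u ∈ homogeneous m) (hv : v ∈ homogeneous n) :
    u * v ∈ homogeneous (m + n) := by
  have h : u * v ∈ homogeneous m * homogeneous n := Submodule.mul_mem_mul hu hv
  rw [homogeneous, homogeneous, Submodule.span_mul_span] at h
  refine Submodule.span_mono ?_ h
  rintro _ ⟨_, ⟨l, hl, rfl⟩, _, ⟨l', hl', rfl⟩, rfl⟩
  exact ⟨l ++ l', (List.length_append).trans (congrArg₂ _ hl hl'),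
    word_append l l'⟩

theorem e_mem_homogeneous (r : ℤ) : e r ∈ homogeneous 1 :=
  Submodule.subset_span ⟨[r], rfl, by simp [word]⟩

theorem M_mem_homogeneous (k : ℕ) (n : ℤ) : M k n ∈ homogeneous k := by
  induction k generalizing n with
  | zero => exact Submodule.subset_span ⟨[], rfl, rfl⟩
  | succ k ih =>
    obtain ⟨c, hc⟩ := exists_M_succ_eq k n
    rw [hc, qComm]
    refine Submodule.smul_mem _ _ (sub_mem ?_ (Submodule.smul_mem _ _ ?_))
    · exact homogeneous_mul (ih _) (e_mem_homogeneous _)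
    · rw [add_comm]
      exact homogeneous_mul (e_mem_homogeneous _) (ih _)

/-! ### Evaluating symmetrised words. -/

section Evaluation

variable {F : Type*} [Field F] [Algebra K F] [CharZero F] {z : ℕ → F}
  (h : Generic (algebraMap K F qq) z)

/-- The symbol of a word is a weighted sum over enumerations of the points. -/
theorem exists_symb_word_eq_sum (N : ℕ) (X : Finset ℕ) (hX : #X = N) :
    ∃ (ι : Type) (T : Finset ι) (y : ι → Fin N → ℕ) (w : ι → F),
      (∀ i, (y i).Injective ∧ ∀ j, y i j ∈ X) ∧
      ∀ r : Fin N → ℤ, symb h (word (List.ofFn r)) X = ∑ i ∈ T, w i * ∏ j, z (y i j) ^ r j := by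
  induction N generalizing X with
  | zero =>
    refine ⟨Unit, univ, fun _ => Fin.elim0, fun _ => 1,
      fun _ => ⟨fun j => j.elim0, fun j => j.elim0⟩, fun r => ?_⟩
    simp [word_nil, symb_one, vacuum, card_eq_zero.1 hX]
  | succ N ih =>
    choose ι T y w hy hw using fun a : X => ih (X.erase a) (by
      rw [card_erase_of_mem a.2, hX]; rfl)
    refine ⟨Σ a : X, ι a, univ.sigma T, fun i => Fin.cons (i.1 : ℕ) (y i.1 i.2),
      fun i => leftFactor (algebraMap K F qq) z i.1 (X.erase i.1) * w i.1 i.2, fun i => ⟨?_, ?_⟩,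
      fun r => ?_⟩
    · refine Fin.cons_injective_iff.2 ⟨?_, (hy i.1 i.2).1⟩
      rintro ⟨j, hj⟩
      exact ne_of_mem_erase ((hy i.1 i.2).2 j) hj
    · intro j
      refine Fin.cases i.1.2 (fun j => ?_) j
      exact mem_of_mem_erase ((hy i.1 i.2).2 j)
    · rw [List.ofFn_succ, word_cons, symb_e_mul, leftOp_apply, sum_sigma, ← sum_coe_sort X]
      refine sum_congr rfl fun a _ => ?_
      rw [hw, mul_sum]
      refine sum_congr rfl fun i _ => ?_
      rw [Fin.prod_univ_succ]
      simp only [Fin.cons_zero, Fin.cons_succ]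
      ring

/-- The symbol of `e 0 ^ N` is a nonzero constant on sets of `N` points. -/
theorem exists_symb_word_zero (N : ℕ) : ∃ d : F, d ≠ 0 ∧ ∀ X : Finset ℕ, #X = N →
    symb h (word (List.ofFn (0 : Fin N → ℤ))) X = d := by
  induction N with
  | zero =>
    refine ⟨1, one_ne_zero, fun X hX => ?_⟩
    simp [word_nil, symb_one, vacuum, card_eq_zero.1 hX]
  | succ N ih =>
    obtain ⟨d, hd, hd'⟩ := ih
    set Q := algebraMap K F qq with hQ
    have hQ1 : Q - 1 ≠ 0 := sub_ne_zero.2 fun H => h.one_sub_ne_zero (by rw [H, sub_self])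
    have hQN : Q ^ (N + 1) - 1 ≠ 0 := by
      refine sub_ne_zero.2 fun H => qq_pow_ne_one N.succ_ne_zero ?_
      apply (algebraMap K F).injective
      rw [map_pow, map_one]; exact H
    refine ⟨(-1) ^ N * (Q ^ (N + 1) - 1) / (Q - 1) * d, mul_ne_zero (div_ne_zero (mul_ne_zero
      (pow_ne_zero _ (neg_ne_zero.2 one_ne_zero)) hQN) hQ1) hd, fun X hX => ?_⟩
    rw [List.ofFn_succ, word_cons, symb_e_mul, leftOp_apply, ← sum_leftFactor h hX,
      mul_div_cancel_left₀ _ hQ1, sum_mul]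
    refine sum_congr rfl fun a ha => ?_
    rw [← hd' (X.erase a) (by rw [card_erase_of_mem ha, hX]; rfl), Pi.zero_apply, zpow_zero, one_mul]
    rfl

/-- The value at `z` of a Laurent polynomial. -/
noncomputable def laurentEval (z : ℕ → F) (N : ℕ) : ((Fin N → ℤ) →₀ K) →ₗ[K] F :=
  Finsupp.linearCombination K fun r => ∏ j : Fin N, z j ^ r j

/-- The weights in `exists_symb_word_eq_sum` do not depend on the exponents. Symmetrising makes
every enumeration of the points contribute the same sum, leaving only the total weight, which is the
value at zero exponents. -/
theorem exists_symb_symWord_eq (N : ℕ) : ∃ d : F, d ≠ 0 ∧ ∀ r : Fin N → ℤ,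
    symb h (symWord r) (range N) = d * ∑ σ : Equiv.Perm (Fin N), ∏ j : Fin N, z j ^ r (σ j) := by
  obtain ⟨d, hd, hd'⟩ := exists_symb_word_zero h N
  refine ⟨d, hd, fun r => ?_⟩
  obtain ⟨ι, T, y, w, hy, hw⟩ := exists_symb_word_eq_sum h N (range N) (card_range N)
  have hτ : ∀ i, ∃ τ : Equiv.Perm (Fin N), ∀ j, y i j = τ j := by
    intro i
    let f : Fin N → Fin N := fun j => ⟨y i j, mem_range.1 ((hy i).2 j)⟩
    have hf : f.Injective := fun a b hab => (hy i).1 (congrArg Fin.val hab)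
    exact ⟨Equiv.ofBijective f (Finite.injective_iff_bijective.1 hf), fun j => rfl⟩
  have hsum : ∀ i, ∑ σ : Equiv.Perm (Fin N), ∏ j, z (y i j) ^ r (σ j) =
      ∑ σ : Equiv.Perm (Fin N), ∏ j : Fin N, z j ^ r (σ j) := by
    intro i
    obtain ⟨τ, hτ⟩ := hτ i
    rw [← Equiv.sum_comp (Equiv.mulRight τ)]
    refine sum_congr rfl fun σ _ => ?_
    rw [← Equiv.prod_comp τ (fun j : Fin N => z j ^ r (σ j))]
    refine prod_congr rfl fun j _ => ?_
    rw [hτ]; rfl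
  have hd2 : d = ∑ i ∈ T, w i := by
    rw [← hd' _ (card_range N), hw]
    simp
  rw [symWord, map_sum, Finset.sum_apply, sum_congr rfl fun (σ : Equiv.Perm (Fin N)) _ => hw (r ∘ σ), sum_comm, hd2, sum_mul]
  refine sum_congr rfl fun i _ => ?_
  rw [← mul_sum]
  congr 1
  exact hsum i

/-- One coefficient family `f` describes both `u` and its symbol, so if the Laurent polynomial
forces `f` to vanish, then `u` vanishes too. -/
theorem exists_laurent (N : ℕ) : ∃ d : F, d ≠ 0 ∧ ∀ u ∈ homogeneous N,
    ∃ f : (Fin N → ℤ) →₀ K,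
      u = Finsupp.linearCombination K (fun r => word (List.ofFn r)) f ∧
        symb h u (range N) = d * laurentEval z N f := by
  obtain ⟨d, hd, hd'⟩ := exists_symb_symWord_eq h N
  refine ⟨d, hd, fun u hu => ?_⟩
  have hu' := homogeneous_le_span N hu
  clear hu
  induction hu' using Submodule.span_induction with
  | mem x hx =>
    obtain ⟨r, rfl⟩ := hx
    refine ⟨∑ σ : Equiv.Perm (Fin N), Finsupp.single (r ∘ σ) 1, ?_, ?_⟩
    · simp [symWord]
    · rw [hd', laurentEval, map_sum]
      simp
  | zero => exact ⟨0, by simp, by simp⟩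
  | add x y _ _ hx hy =>
    obtain ⟨f, rfl, hf⟩ := hx
    obtain ⟨g, rfl, hg⟩ := hy
    exact ⟨f + g, by rw [map_add], by rw [map_add, Pi.add_apply, hf, hg, map_add, mul_add]⟩
  | smul c x _ hx =>
    obtain ⟨f, rfl, hf⟩ := hx
    exact ⟨c • f, by rw [map_smul], by
      rw [map_smul, Pi.smul_apply, hf, map_smul, mul_smul_comm]⟩

end Evaluation

/-! ### Injectivity at independent variables. -/

/-- The field of rational functions in the variables `z i`. -/
abbrev RatField : Type := FractionRing (MvPolynomial ℕ K)

/-- The variables of `RatField`. -/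
noncomputable def var (i : ℕ) : RatField := algebraMap (MvPolynomial ℕ K) RatField (MvPolynomial.X i)

instance : CharZero RatField :=
  charZero_of_injective_algebraMap (algebraMap K RatField).injective

theorem algebraMap_ratField_injective :
    Function.Injective (algebraMap (MvPolynomial ℕ K) RatField) :=
  IsFractionRing.injective _ _

theorem generic_var : Generic (algebraMap K RatField qq) var where
  param_ne_zero := (map_ne_zero _).2 qq_ne_zero
  ne_zero i := by
    rw [var, Ne, map_eq_zero_iff _ algebraMap_ratField_injective]
    exact MvPolynomial.X_ne_zero i
  injective i j hij := MvPolynomial.X_injective (algebraMap_ratField_injective hij)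
  ne_mul i j hij := by
    rw [IsScalarTower.algebraMap_apply K (MvPolynomial ℕ K) RatField, var, var, ← map_mul] at hij
    -- Setting all variables to 1 would give 𝔮 = 1.
    have h := congrArg (MvPolynomial.eval fun _ => (1 : K)) (algebraMap_ratField_injective hij)
    simp only [MvPolynomial.algebraMap_eq, map_mul, MvPolynomial.eval_X, MvPolynomial.eval_C,
      mul_one] at h
    exact qq_pow_ne_one one_ne_zero (by rw [pow_one, ← h])

theorem laurentEval_var_injective (N : ℕ) {f : (Fin N → ℤ) →₀ K}
    (hf : laurentEval var N f = 0) : f = 0 := by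
  -- Multiplication by (∏ z_j)^C clears all negative exponents, so distinct exponents give distinct
  -- monomials of a polynomial.
  obtain ⟨C, hC⟩ : ∃ C : ℕ, ∀ r ∈ f.support, ∀ j, 0 ≤ r j + C := by
    refine ⟨f.support.sup fun r => univ.sup fun j => (r j).natAbs, fun r hr j => ?_⟩
    have h1 := le_sup (f := fun r : Fin N → ℤ => univ.sup fun j => (r j).natAbs) hr
    have h2 := le_sup (f := fun j => (r j).natAbs) (mem_univ j)
    have h3 := h2.trans h1
    omega
  set m : (Fin N → ℤ) → ℕ →₀ ℕ := fun r =>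
    (Finsupp.equivFunOnFinite.symm fun j : Fin N => (r j + C).toNat).embDomain Fin.valEmbedding
    with hm
  have hmj : ∀ r (j : Fin N), m r j = (r j + C).toNat := fun r j => by
    have := Finsupp.embDomain_apply_self Fin.valEmbedding
      (Finsupp.equivFunOnFinite.symm fun j : Fin N => (r j + C).toNat) j
    exact this
  have hmon : ∀ r ∈ f.support, (∏ j : Fin N, var j ^ r j) * ∏ j : Fin N, var j ^ C =
      algebraMap (MvPolynomial ℕ K) RatField (MvPolynomial.monomial (m r) 1) := by
    intro r hr
    rw [MvPolynomial.monomial_eq, map_one, one_mul, hm, Finsupp.prod_embDomain,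
      Finsupp.prod_fintype _ _ (by simp), map_prod, ← prod_mul_distrib]
    refine prod_congr rfl fun j _ => ?_
    rw [map_pow, ← zpow_natCast, ← zpow_natCast, ← zpow_add₀ (generic_var.ne_zero _)]
    simp only [Finsupp.equivFunOnFinite_symm_apply_apply]
    rw [Int.toNat_of_nonneg (hC r hr j)]
    rfl
  set P : MvPolynomial ℕ K := ∑ r ∈ f.support, MvPolynomial.monomial (m r) (f r) with hP
  have hP0 : P = 0 := by
    apply algebraMap_ratField_injective
    rw [map_zero, ← zero_mul (∏ j : Fin N, var j ^ C), ← hf, laurentEval,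
      Finsupp.linearCombination_apply, Finsupp.sum, sum_mul, hP, map_sum]
    refine sum_congr rfl fun r hr => ?_
    rw [smul_mul_assoc, hmon r hr, ← mul_one (f r), ← smul_eq_mul, ← MvPolynomial.smul_monomial,
      smul_eq_mul, mul_one]
    exact map_smul (IsScalarTower.toAlgHom K (MvPolynomial ℕ K) RatField) _ _
  ext r₀
  by_contra hr₀
  have hr₀' : r₀ ∈ f.support := Finsupp.mem_support_iff.2 hr₀
  have h1 := congrArg (MvPolynomial.coeff (m r₀)) hP0
  rw [hP, MvPolynomial.coeff_sum, sum_eq_single_of_mem r₀ hr₀', MvPolynomial.coeff_monomial,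
    if_pos rfl, MvPolynomial.coeff_zero] at h1
  · exact hr₀ h1
  · intro r hr hne
    rw [MvPolynomial.coeff_monomial, if_neg]
    intro heq
    apply hne
    ext j
    have := DFunLike.congr_fun heq (j : ℕ)
    rw [hmj, hmj] at this
    have h1 := hC r hr j
    have h2 := hC r₀ hr₀' j
    omega

theorem eq_zero_of_symb_eq_zero {N : ℕ} {u : UPos} (hu : u ∈ homogeneous N)
    (h0 : symb generic_var u = 0) : u = 0 := by
  obtain ⟨d, hd, hd'⟩ := exists_laurent generic_var N
  obtain ⟨f, rfl, hf⟩ := hd' u hu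
  rw [h0, Pi.zero_apply, zero_eq_mul] at hf
  rw [laurentEval_var_injective N (hf.resolve_left hd), map_zero]

/-! ### Commutation relations in the algebra. -/

theorem M₁_mul_M (k : ℕ) {n m : ℤ} (hnm : |m - n| ≤ k) :
    M₁ n * M k m = qq ^ (m - n) • (M k m * M₁ n) := by
  rw [← sub_eq_zero]
  refine eq_zero_of_symb_eq_zero (N := k + 1) (sub_mem ?_ (Submodule.smul_mem _ _ ?_)) ?_
  · rw [add_comm]
    exact homogeneous_mul (e_mem_homogeneous _) (M_mem_homogeneous _ _)
  · exact homogeneous_mul (M_mem_homogeneous _ _) (e_mem_homogeneous _)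
  · rw [map_sub, symb_M₁_mul_M generic_var k hnm, sub_self]

/-- Both entries of the bracket defining the next M 𝔮-commute with `M b m`, hence so does the
bracket, and the exponents add. The bound b - a + 1 shrinks by one per step, which keeps the shifted
indices n - 1 and n + a in range. -/
theorem M_mul_M {a b : ℕ} {n m : ℤ} (hab : a ≤ b) (hnm : |m - n| ≤ b - a + 1) :
    M a n * M b m = qq ^ (a * (m - n)) • (M b m * M a n) := by
  induction a generalizing n with
  | zero => simp [M]
  | succ a ih =>
    rw [abs_le] at hnm
    push_cast at hnm
    obtain ⟨c, hc⟩ := exists_M_succ_eq a n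
    have h1 : M a (n - 1) * M b m = qq ^ (a * (m - (n - 1))) • (M b m * M a (n - 1)) :=
      ih (by omega) (by rw [abs_le]; omega)
    have h2 : M₁ (n + a) * M b m = qq ^ (m - (n + a)) • (M b m * M₁ (n + a)) :=
      M₁_mul_M b (by rw [abs_le]; omega)
    have hexp : qq ^ (((a + 1 : ℕ) : ℤ) * (m - n)) =
        qq ^ (m - (n + a)) * qq ^ (a * (m - (n - 1))) := by
      rw [← zpow_add₀ qq_ne_zero]; congr 1; push_cast; ring
    have h3 : M a (n - 1) * M₁ (n + a) * M b m =
        qq ^ (((a + 1 : ℕ) : ℤ) * (m - n)) • (M b m * (M a (n - 1) * M₁ (n + a))) := by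
      rw [mul_assoc, h2, mul_smul_comm, ← mul_assoc, h1, smul_mul_assoc, smul_smul, mul_assoc, hexp]
    have h4 : M₁ (n + a) * M a (n - 1) * M b m =
        qq ^ (((a + 1 : ℕ) : ℤ) * (m - n)) • (M b m * (M₁ (n + a) * M a (n - 1))) := by
      rw [mul_assoc, h1, mul_smul_comm, ← mul_assoc, h2, smul_mul_assoc, smul_smul, mul_assoc, hexp,
        mul_comm (qq ^ (m - _))]
    rw [hc, qComm, smul_mul_assoc, sub_mul, smul_mul_assoc, h3, h4, mul_smul_comm, mul_sub (M b m),
      mul_smul_comm, smul_comm _ c]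
    congr 1
    rw [smul_sub, smul_comm (qq ^ (a + 1))]

end QLoop

theorem proposition6p5 (α β : ℕ) (n : ℤ) (ε : ℕ) (hε : ε = 0 ∨ ε = 1) :
    QLoop.M α n * QLoop.M β (n + (ε : ℤ)) =
      QLoop.qq ^ (min α β * ε) • (QLoop.M β (n + (ε : ℤ)) * QLoop.M α n) := by
  rcases le_total α β with h | h
  · rw [QLoop.M_mul_M h (by rw [abs_le]; omega), min_eq_left h, add_sub_cancel_left,
      ← zpow_natCast, Nat.cast_mul]
  -- The roles are exchanged, so the index difference is -ε and the resulting power cancels 𝔮^{βε}.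
  · rw [QLoop.M_mul_M (n := n + ε) h (by rw [abs_le]; omega), min_eq_right h, smul_smul,
      ← zpow_natCast, ← zpow_add₀ QLoop.qq_ne_zero]
    have : ((β * ε : ℕ) : ℤ) + β * (n - (n + ε)) = 0 := by push_cast; ring
    rw [this, zpow_zero, one_smul]
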